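/- Theorem 3.1 (Bergman space theorem). Let $n\ge 1$, let $A^2(\mathbb D^n)$ be the Hilbert space of holomorphic functions on the unit polydisc $\mathbb D^n$ that are square integrable with respect to the (normalized) product area measure, with the $L^2$ inner product, and let $M_{z_i}$ be multiplication by the $i$-th coordinate function, $1\le i\le n$. Let $\mathcal S$ be a closed subspace of $A^2(\mathbb D^n)$ with $M_{z_i}\mathcal S\subseteq\mathcal S$ for all $i$, put $R_i:=M_{z_i}|_{\mathcal S}:\mathcal S\to\mathcal S$, and suppose that $\mathcal S$ is doubly commuting, i.e. $R_iR_j^*=R_j^*R_i$ for all $1\le i<j\le n$. Let $\alpha=\{\alpha_1,\dots,\alpha_k\}$ ($k\ge1$, the $\alpha_j$ distinct, listed in any order) be a non-empty subset of $\{1,\dots,n\}$. Then the closed subspace $$\mathcal W:=\bigcap_{j=1}^k\left(\mathcal S\ominus z_{\alpha_j}\mathcal S\right)$$ of $\mathcal S$ is a wandering subspace for the tuple $M_\alpha|_{\mathcal S}=(R_{\alpha_1},\dots,R_{\alpha_k})$, that is, $$\mathcal W\perp R_{\alpha_1}^{l_1}\cdots R_{\alpha_k}^{l_k}\mathcal W\quad\text{for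 all } (l_1,\dots,l_k)\in\mathbb N^k\setminus\{(0,\dots,0)\},$$ $$\mathcal S=\overline{\operatorname{span}}\{R_{\alpha_1}^{l_1}\cdots R_{\alpha_k}^{l_k}h : h\in\mathcal W,\ l_1,\dots,l_k\in\mathbb N\},$$ where $\mathbb N=\{0,1,2,\dots\}$. -/

import Mathlib

open MeasureTheory Filter Topology Metric
open scoped InnerProductSpace ENNReal

namespace BergmanPolydisc

/-- The open unit polydisc in `ℂⁿ`. -/
def polydisc (n : ℕ) : Set (Fin n → ℂ) := {z | ∀ i, ‖z i‖ < 1}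

lemma polydisc_eq_ball (n : ℕ) : polydisc n = ball 0 1 := by
  ext z
  simp [polydisc, pi_norm_lt_iff]

lemma isOpen_polydisc (n : ℕ) : IsOpen (polydisc n) := by
  rw [polydisc_eq_ball]; exact isOpen_ball

/-- Normalized area measure `dA = π⁻¹ dx dy` on the unit disc. -/
noncomputable def discMeasure : Measure ℂ := NNReal.pi⁻¹ • volume.restrict (ball 0 1)

instance : IsProbabilityMeasure discMeasure := by
  constructor
  have h : (NNReal.pi : ℝ≥0∞) ≠ 0 := by simpa using NNReal.pi_ne_zero
  rw [discMeasure, Measure.smul_apply, Measure.restrict_apply_univ, Complex.volume_ball,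
    ENNReal.smul_def, ENNReal.coe_inv NNReal.pi_ne_zero]
  simp [ENNReal.inv_mul_cancel h ENNReal.coe_ne_top]

/-- The product area measure on the polydisc. -/
noncomputable def polydiscMeasure (n : ℕ) : Measure (Fin n → ℂ) :=
  Measure.pi fun _ => discMeasure

instance (n : ℕ) : IsProbabilityMeasure (polydiscMeasure n) := by
  unfold polydiscMeasure; infer_instance

lemma polydiscMeasure_eq (n : ℕ) :
    polydiscMeasure n = (NNReal.pi⁻¹ ^ n) • volume.restrict (polydisc n) := by
  refine Measure.pi_eq fun s hs => ?_
  have h : Set.univ.pi s ∩ polydisc n = Set.univ.pi fun i => s i ∩ ball 0 1 := by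
    ext z; simp [polydisc, forall_and]
  rw [Measure.smul_apply, Measure.restrict_apply (MeasurableSet.univ_pi hs), h, volume_pi_pi]
  simp only [discMeasure, Measure.smul_apply, Measure.restrict_apply (hs _), ENNReal.smul_def,
    smul_eq_mul, Finset.prod_mul_distrib, Finset.prod_const, Finset.card_univ, Fintype.card_fin,
    ENNReal.coe_pow]

lemma ae_mem_polydisc (n : ℕ) : ∀ᵐ z ∂(polydiscMeasure n), z ∈ polydisc n := by
  rw [polydiscMeasure_eq]
  exact Measure.ae_smul_measure (ae_restrict_mem (isOpen_polydisc n).measurableSet) _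

lemma measurePreserving_rot (n : ℕ) (u : Circle) :
    MeasurePreserving (fun w : Fin n → ℂ => fun i => (u : ℂ) * w i) volume volume :=
  volume_preserving_pi fun _ => (rotation u).measurePreserving

lemma rot_average {n : ℕ} (g : (Fin n → ℂ) → ℂ) (z : Fin n → ℂ) {r : ℝ}
    (hg : DifferentiableOn ℂ g (polydisc n)) (hz : closedBall z r ⊆ polydisc n) :
    ∫ w in closedBall 0 r, g (z + w) = (volume.real (closedBall (0 : Fin n → ℂ) r)) • g z := by
  have hmem : ∀ w ∈ closedBall (0 : Fin n → ℂ) r, ∀ c : ℂ, ‖c‖ ≤ 1 → z + c • w ∈ polydisc n := by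
    intro w hw c hc
    apply hz
    simp only [mem_closedBall, dist_self_add_left, norm_smul] at *
    rw [dist_zero_right] at hw
    exact (mul_le_of_le_one_left (norm_nonneg _) hc).trans hw
  have hcirc : ∀ θ : ℝ, ‖circleMap 0 1 θ‖ = 1 := by intro θ; simp
  have hrot : ∀ θ : ℝ, ∫ w in closedBall 0 r, g (z + circleMap 0 1 θ • w)
      = ∫ w in closedBall 0 r, g (z + w) := by
    intro θ
    have hp := measurePreserving_rot n (Circle.exp θ)
    have hc : ((Circle.exp θ : Circle) : ℂ) = circleMap 0 1 θ := by simp [circleMap]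
    have he : MeasurableEmbedding (fun w : Fin n → ℂ => fun i => (Circle.exp θ : ℂ) * w i) := by
      have := (Homeomorph.smulOfNeZero (α := Fin n → ℂ) ((Circle.exp θ : Circle) : ℂ)
        (Circle.coe_ne_zero _)).measurableEmbedding
      exact this
    have := hp.setIntegral_preimage_emb he (fun w => g (z + w)) (closedBall 0 r)
    rw [← this]
    have hpre : (fun w : Fin n → ℂ => fun i => (Circle.exp θ : ℂ) * w i) ⁻¹' closedBall 0 r
        = closedBall 0 r := by
      ext w
      have h : (fun i => (Circle.exp θ : ℂ) * w i) = (Circle.exp θ : ℂ) • w := rfl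
      rw [Set.mem_preimage, h, mem_closedBall_zero_iff, mem_closedBall_zero_iff, norm_smul,
        Circle.norm_coe, one_mul]
    rw [hpre]
    congr 1
    ext w
    rw [← hc]; rfl
  have hav : ∀ w ∈ closedBall (0 : Fin n → ℂ) r,
      ∫ θ in (0 : ℝ)..2 * Real.pi, g (z + circleMap 0 1 θ • w) = (2 * Real.pi) • g z := by
    intro w hw
    have hd : DifferentiableOn ℂ (fun c : ℂ => g (z + c • w)) (closedBall 0 1) := by
      refine hg.comp (by fun_prop) fun c hc => hmem w hw c (by simpa using hc)
    have h1 : DiffContOnCl ℂ (fun c : ℂ => g (z + c • w)) (ball 0 |1|) :=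
      DifferentiableOn.diffContOnCl (by
        rw [abs_one, closure_ball _ one_ne_zero]; exact hd)
    have := h1.circleAverage
    rw [Real.circleAverage_def, zero_smul, add_zero] at this
    rw [← this, smul_smul, mul_inv_cancel₀ (by positivity), one_smul]
  have hswap : ∫ θ in Set.Icc (0 : ℝ) (2 * Real.pi), ∫ w in closedBall 0 r,
        g (z + circleMap 0 1 θ • w)
      = ∫ w in closedBall 0 r, ∫ θ in Set.Icc (0 : ℝ) (2 * Real.pi),
        g (z + circleMap 0 1 θ • w) := by
    apply integral_integral_swap
    rw [Measure.prod_restrict]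
    refine ContinuousOn.integrableOn_compact (isCompact_Icc.prod (isCompact_closedBall _ _)) ?_
    refine hg.continuousOn.comp (by fun_prop) ?_
    rintro ⟨θ, w⟩ ⟨-, hw⟩
    exact hmem w hw _ (hcirc θ).le
  simp_rw [hrot] at hswap
  have h2 : ∫ w in closedBall 0 r, ∫ θ in Set.Icc (0 : ℝ) (2 * Real.pi),
        g (z + circleMap 0 1 θ • w) = ∫ w in closedBall (0 : Fin n → ℂ) r, (2 * Real.pi) • g z := by
    refine setIntegral_congr_fun measurableSet_closedBall fun w hw => ?_
    rw [← hav w hw, intervalIntegral.integral_of_le (by positivity), integral_Icc_eq_integral_Ioc]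
  rw [h2, setIntegral_const, setIntegral_const, smul_comm] at hswap
  have h3 : volume.real (Set.Icc (0 : ℝ) (2 * Real.pi)) = 2 * Real.pi := by
    rw [Real.volume_real_Icc_of_le (by positivity), sub_zero]
  rw [h3] at hswap
  exact smul_right_injective ℂ (by positivity : (2 * Real.pi) ≠ 0) hswap

lemma pointwise_bound (n : ℕ) {r : ℝ} (hr : 0 < r) : ∃ C : ℝ, 0 < C ∧
    ∀ (g : (Fin n → ℂ) → ℂ) (z : Fin n → ℂ), DifferentiableOn ℂ g (polydisc n) →
      MemLp g 2 (polydiscMeasure n) → closedBall z r ⊆ polydisc n →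
      ‖g z‖ ≤ C * (eLpNorm g 2 (polydiscMeasure n)).toReal := by
  set V := volume.real (closedBall (0 : Fin n → ℂ) r)
  have hV : 0 < V := ENNReal.toReal_pos (measure_closedBall_pos _ _ hr).ne'
    measure_closedBall_lt_top.ne
  have hpi : (0 : ℝ) < (NNReal.pi : ℝ) ^ n := pow_pos (by simpa using Real.pi_pos) n
  refine ⟨V⁻¹ * (NNReal.pi : ℝ) ^ n, by positivity, fun g z hg hL hz => ?_⟩
  have hint : Integrable g (polydiscMeasure n) := hL.integrable (by norm_num)
  have hle : ∫ w, ‖g w‖ ∂(polydiscMeasure n) ≤ (eLpNorm g 2 (polydiscMeasure n)).toReal := by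
    rw [integral_norm_eq_lintegral_enorm hL.1, ← eLpNorm_one_eq_lintegral_enorm]
    exact ENNReal.toReal_mono hL.2.ne (eLpNorm_le_eLpNorm_of_exponent_le (by norm_num) hL.1)
  have heq : ∫ w in polydisc n, ‖g w‖ = (NNReal.pi : ℝ) ^ n * ∫ w, ‖g w‖ ∂(polydiscMeasure n) := by
    rw [polydiscMeasure_eq, integral_smul_nnreal_measure, NNReal.smul_def, smul_eq_mul,
      ← mul_assoc, NNReal.coe_pow, NNReal.coe_inv, ← mul_pow, mul_inv_cancel₀, one_pow, one_mul]
    simp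
  have hintD : IntegrableOn g (polydisc n) := by
    rw [polydiscMeasure_eq] at hint
    have h0 : ((NNReal.pi⁻¹ ^ n : NNReal) : ℝ≥0∞) ≠ 0 := by simp [NNReal.pi_ne_zero]
    exact (integrable_smul_measure h0 ENNReal.coe_ne_top).1 hint
  have htr : ∫ w in closedBall (0 : Fin n → ℂ) r, ‖g (z + w)‖ = ∫ w in closedBall z r, ‖g w‖ := by
    have := (measurePreserving_add_left (volume : Measure (Fin n → ℂ)) z).setIntegral_preimage_emb
      (measurableEmbedding_addLeft z) (fun w => ‖g w‖) (closedBall z r)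
    rw [← this]
    congr 2
    ext w; simp
  have h1 : V * ‖g z‖ ≤ (NNReal.pi : ℝ) ^ n * (eLpNorm g 2 (polydiscMeasure n)).toReal := by
    calc V * ‖g z‖ = ‖∫ w in closedBall 0 r, g (z + w)‖ := by
          rw [rot_average g z hg hz, norm_smul, Real.norm_of_nonneg hV.le]
      _ ≤ ∫ w in closedBall 0 r, ‖g (z + w)‖ := norm_integral_le_integral_norm _
      _ = ∫ w in closedBall z r, ‖g w‖ := htr
      _ ≤ ∫ w in polydisc n, ‖g w‖ :=
          setIntegral_mono_set hintD.norm (ae_of_all _ fun _ => norm_nonneg _)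
            (ae_of_all _ hz)
      _ ≤ _ := by rw [heq]; gcongr
  rw [mul_assoc, inv_mul_eq_div, le_div_iff₀ hV, mul_comm]
  exact h1


lemma fderiv_bound (n : ℕ) {r : ℝ} (hr : 0 < r) : ∃ C : ℝ, 0 < C ∧
    ∀ (g : (Fin n → ℂ) → ℂ) (z : Fin n → ℂ), DifferentiableOn ℂ g (polydisc n) →
      MemLp g 2 (polydiscMeasure n) → closedBall z (2 * r) ⊆ polydisc n →
      ‖fderiv ℂ g z‖ ≤ C * (eLpNorm g 2 (polydiscMeasure n)).toReal := by
  obtain ⟨C, hC, h⟩ := pointwise_bound n hr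
  refine ⟨2 * C / r, by positivity, fun g z hg hL hz => ?_⟩
  have hsub : ball z r ⊆ polydisc n :=
    (ball_subset_closedBall.trans (closedBall_subset_closedBall (by linarith))).trans hz
  have hb : ∀ w ∈ ball z r, ‖g w‖ ≤ C * (eLpNorm g 2 (polydiscMeasure n)).toReal := by
    intro w hw
    refine h g w hg hL (Set.Subset.trans (closedBall_subset_closedBall' ?_) hz)
    have := mem_ball.1 hw
    linarith
  have hmaps : Set.MapsTo g (ball z r)
      (closedBall (g z) (2 * (C * (eLpNorm g 2 (polydiscMeasure n)).toReal))) := by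
    intro w hw
    rw [mem_closedBall, dist_eq_norm]
    have h1 := hb w hw
    have h2 := hb z (mem_ball_self hr)
    exact (norm_sub_le _ _).trans (by linarith)
  refine (Complex.norm_fderiv_le_div_of_mapsTo_ball (hg.mono hsub) hmaps hr).trans_eq ?_
  ring

/-- The Bergman space `A²(𝔻ⁿ)` as a subspace of `L²`: the classes in `L²(𝔻ⁿ, dA)` of square
integrable holomorphic functions on the polydisc. -/
noncomputable def bergman (n : ℕ) : Submodule ℂ (Lp ℂ 2 (polydiscMeasure n)) where
  carrier := {f | ∃ g : (Fin n → ℂ) → ℂ,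
    DifferentiableOn ℂ g (polydisc n) ∧ f =ᵐ[polydiscMeasure n] g}
  zero_mem' := ⟨0, differentiableOn_const 0, Lp.coeFn_zero _ _ _⟩
  add_mem' := by
    rintro f f' ⟨g, hg, hfg⟩ ⟨g', hg', hfg'⟩
    exact ⟨g + g', hg.add hg', (Lp.coeFn_add f f').trans (hfg.add hfg')⟩
  smul_mem' := by
    rintro c f ⟨g, hg, hfg⟩
    exact ⟨c • g, hg.const_smul c, (Lp.coeFn_smul c f).trans (hfg.const_smul c)⟩

lemma bergman_isClosed (n : ℕ) : IsClosed (bergman n : Set (Lp ℂ 2 (polydiscMeasure n))) := by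
  refine isClosed_of_closure_subset fun f hf => ?_
  obtain ⟨F, hF, hlim⟩ := mem_closure_iff_seq_limit.1 hf
  choose g hg hFg using hF
  have hL : ∀ k l, MemLp (g k - g l) 2 (polydiscMeasure n) := fun k l =>
    ((Lp.memLp (F k)).ae_eq (hFg k)).sub ((Lp.memLp (F l)).ae_eq (hFg l))
  have hnorm : ∀ k l, (eLpNorm (g k - g l) 2 (polydiscMeasure n)).toReal = ‖F k - F l‖ := by
    intro k l
    rw [Lp.norm_def, eLpNorm_congr_ae ((Lp.coeFn_sub (F k) (F l)).trans ((hFg k).sub (hFg l)))]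
  have hcau := Metric.cauchySeq_iff.1 hlim.cauchySeq
  have hdiffAt : ∀ k, ∀ z ∈ polydisc n, DifferentiableAt ℂ (g k) z := fun k z hz =>
    (hg k z hz).differentiableAt ((isOpen_polydisc n).mem_nhds hz)
  have key : ∀ z ∈ polydisc n, ∃ r > 0, ball z r ⊆ polydisc n ∧
      UniformCauchySeqOn g atTop (ball z r) ∧
      UniformCauchySeqOn (fun k => fderiv ℂ (g k)) atTop (ball z r) := by
    intro z hz
    obtain ⟨R, hR, hRs⟩ := Metric.isOpen_iff.1 (isOpen_polydisc n) z hz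
    have hr : 0 < R / 4 := by linarith
    have hcl : ∀ w ∈ ball z (R / 4), closedBall w (2 * (R / 4)) ⊆ polydisc n := by
      intro w hw
      refine Set.Subset.trans (closedBall_subset_ball' ?_) hRs
      have := mem_ball.1 hw
      linarith
    have hb : ball z (R / 4) ⊆ polydisc n :=
      (ball_subset_ball (by linarith)).trans hRs
    obtain ⟨C, hC, h1⟩ := pointwise_bound n hr
    obtain ⟨C', hC', h2⟩ := fderiv_bound n hr
    refine ⟨R / 4, hr, hb, ?_, ?_⟩
    · rw [Metric.uniformCauchySeqOn_iff]
      intro ε hε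
      obtain ⟨N, hN⟩ := hcau (ε / C) (by positivity)
      refine ⟨N, fun k hk l hl w hw => ?_⟩
      have h3 := h1 (g k - g l) w ((hg k).sub (hg l)) (hL k l)
        ((closedBall_subset_closedBall (by linarith)).trans (hcl w hw))
      have h4 := hN k hk l hl
      rw [hnorm, Pi.sub_apply] at h3
      rw [dist_eq_norm, lt_div_iff₀ hC] at h4
      rw [dist_eq_norm]
      linarith
    · rw [Metric.uniformCauchySeqOn_iff]
      intro ε hε
      obtain ⟨N, hN⟩ := hcau (ε / C') (by positivity)
      refine ⟨N, fun k hk l hl w hw => ?_⟩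
      have h3 := h2 (g k - g l) w ((hg k).sub (hg l)) (hL k l) (hcl w hw)
      have h4 := hN k hk l hl
      rw [hnorm, fderiv_sub (hdiffAt k w (hb hw)) (hdiffAt l w (hb hw))] at h3
      rw [dist_eq_norm, lt_div_iff₀ hC'] at h4
      rw [dist_eq_norm]
      linarith
  have hpt : ∀ z ∈ polydisc n, ∃ y, Tendsto (fun k => g k z) atTop (𝓝 y) := by
    intro z hz
    obtain ⟨r, hr, -, h, -⟩ := key z hz
    exact cauchySeq_tendsto_of_complete (h.cauchySeq (mem_ball_self hr))
  have hpt' : ∀ z ∈ polydisc n, ∃ y, Tendsto (fun k => fderiv ℂ (g k) z) atTop (𝓝 y) := by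
    intro z hz
    obtain ⟨r, hr, -, -, h⟩ := key z hz
    exact cauchySeq_tendsto_of_complete (h.cauchySeq (mem_ball_self hr))
  choose! G hG using hpt
  choose! G' hG' using hpt'
  refine ⟨G, fun z hz => ?_, ?_⟩
  · obtain ⟨r, hr, hs, -, h⟩ := key z hz
    refine (hasFDerivAt_of_tendstoUniformlyOn isOpen_ball
      (h.tendstoUniformlyOn_of_tendsto fun w hw => hG' w (hs hw))
      (fun k w hw => (hdiffAt k w (hs hw)).hasFDerivAt) (fun w hw => hG w (hs hw))
      (mem_ball_self hr)).differentiableAt.differentiableWithinAt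
  · obtain ⟨φ, hφ, hae⟩ := (tendstoInMeasure_of_tendsto_Lp hlim).exists_seq_tendsto_ae
    filter_upwards [hae, ae_all_iff.2 hFg, ae_mem_polydisc n] with z h1 h2 h3
    simp_rw [h2] at h1
    exact tendsto_nhds_unique h1 ((hG z h3).comp hφ.tendsto_atTop)

/-- The Bergman space `A²(𝔻ⁿ)` as a Hilbert space, with the inner product of `L²(𝔻ⁿ, dA)`. -/
def BergmanSpace (n : ℕ) : Type := bergman n

noncomputable instance (n : ℕ) : NormedAddCommGroup (BergmanSpace n) :=
  inferInstanceAs (NormedAddCommGroup (bergman n))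

noncomputable instance (n : ℕ) : InnerProductSpace ℂ (BergmanSpace n) :=
  inferInstanceAs (InnerProductSpace ℂ (bergman n))

instance (n : ℕ) : CompleteSpace (BergmanSpace n) := (bergman_isClosed n).completeSpace_coe

lemma memLp_coord_mul {n : ℕ} (i : Fin n) (f : Lp ℂ 2 (polydiscMeasure n)) :
    MemLp (fun z => z i * f z) 2 (polydiscMeasure n) := by
  refine (Lp.memLp f).of_le ((measurable_pi_apply i).aestronglyMeasurable.mul
    (Lp.aestronglyMeasurable f)) ?_
  filter_upwards [ae_mem_polydisc n] with z hz
  rw [norm_mul]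
  exact mul_le_of_le_one_left (norm_nonneg _) (hz i).le

/-- Multiplication by the coordinate `z_i` on `L²(𝔻ⁿ, dA)`. -/
noncomputable def coordMulLp {n : ℕ} (i : Fin n) :
    Lp ℂ 2 (polydiscMeasure n) →L[ℂ] Lp ℂ 2 (polydiscMeasure n) :=
  LinearMap.mkContinuous
    { toFun := fun f => (memLp_coord_mul i f).toLp (fun z => z i * f z)
      map_add' := fun f g => by
        refine Lp.ext ?_
        filter_upwards [Lp.coeFn_add f g, (memLp_coord_mul i f).coeFn_toLp,
          (memLp_coord_mul i g).coeFn_toLp, (memLp_coord_mul i (f + g)).coeFn_toLp,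
          Lp.coeFn_add ((memLp_coord_mul i f).toLp _) ((memLp_coord_mul i g).toLp _)]
          with z h1 h2 h3 h4 h5
        rw [h4, h5, h1, Pi.add_apply, Pi.add_apply, h2, h3, mul_add]
      map_smul' := fun c f => by
        refine Lp.ext ?_
        filter_upwards [Lp.coeFn_smul c f, (memLp_coord_mul i f).coeFn_toLp,
          (memLp_coord_mul i (c • f)).coeFn_toLp,
          Lp.coeFn_smul c ((memLp_coord_mul i f).toLp _)] with z h1 h2 h3 h4
        rw [h3, RingHom.id_apply, h4, h1, Pi.smul_apply, Pi.smul_apply, h2, smul_eq_mul,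
          smul_eq_mul, mul_left_comm] }
    1 (fun f => by
      rw [one_mul]
      refine Lp.norm_le_norm_of_ae_le ?_
      filter_upwards [(memLp_coord_mul i f).coeFn_toLp, ae_mem_polydisc n] with z h1 hz
      change ‖((memLp_coord_mul i f).toLp _ : (Fin n → ℂ) → ℂ) z‖ ≤ _
      rw [h1, norm_mul]
      exact mul_le_of_le_one_left (norm_nonneg _) (hz i).le)

lemma coordMulLp_mem {n : ℕ} (i : Fin n) :
    ∀ f ∈ bergman n, coordMulLp i f ∈ bergman n := by
  rintro f ⟨g, hg, hfg⟩
  refine ⟨fun z => z i * g z, (by fun_prop : DifferentiableOn ℂ (fun z : Fin n → ℂ => z i)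
    (polydisc n)).mul hg, (memLp_coord_mul i f).coeFn_toLp.trans ?_⟩
  filter_upwards [hfg] with z hz
  rw [hz]

/-- The coordinate multiplication operator `M_{z_i} : A²(𝔻ⁿ) → A²(𝔻ⁿ)`, `f ↦ z_i f`. -/
noncomputable def coordMul {n : ℕ} (i : Fin n) : BergmanSpace n →L[ℂ] BergmanSpace n :=
  ((coordMulLp i).restrict (coordMulLp_mem i) : bergman n →L[ℂ] bergman n)

section Operators

variable {H : Type*} [NormedAddCommGroup H] [InnerProductSpace ℂ H]

/-- A tuple `(T₁, …, Tₙ)` of bounded operators on a Hilbert space is doubly commuting if it is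
commuting and `T_i T_j^* = T_j^* T_i` for all `i < j`. -/
def IsDoublyCommuting [CompleteSpace H] {n : ℕ} (T : Fin n → H →L[ℂ] H) : Prop :=
  (∀ i j, T i ∘L T j = T j ∘L T i) ∧
    ∀ i j, i < j → T i ∘L (T j).adjoint = (T j).adjoint ∘L T i

/-- The monomial `T₁ ^ l₁ T₂ ^ l₂ ⋯ T_k ^ l_k` in the operators of a tuple. -/
def monomialOp {k : ℕ} (T : Fin k → H →L[ℂ] H) (l : Fin k → ℕ) : H →L[ℂ] H :=
  (List.ofFn fun i => T i ^ l i).prod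

/-- A closed subspace `W` of `H` is a wandering subspace for `(T₁, …, T_k)` if
`W ⟂ T₁ ^ l₁ ⋯ T_k ^ l_k W` for all `l ≠ 0` and the vectors `T₁ ^ l₁ ⋯ T_k ^ l_k h`, `h ∈ W`,
span a dense subspace of `H`. -/
def IsWanderingSubspace {k : ℕ} (T : Fin k → H →L[ℂ] H) (W : Submodule ℂ H) : Prop :=
  IsClosed (W : Set H) ∧
    (∀ l : Fin k → ℕ, l ≠ 0 → W ⟂ W.map (monomialOp T l).toLinearMap) ∧
    (Submodule.span ℂ {v | ∃ l : Fin k → ℕ, ∃ h ∈ W, v = monomialOp T l h}).topologicalClosure = ⊤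

/-- The closed subspace `⋂ⱼ (H ⊖ T_j H)` attached to a tuple `(T₁, …, T_k)` on `H`. -/
noncomputable def defectSpace {k : ℕ} (T : Fin k → H →L[ℂ] H) : Submodule ℂ H :=
  ⨅ j, (T j).rangeᗮ

end Operators

/-- The operator `M_{z_i}|_S` on an invariant subspace `S` of the Bergman space. -/
noncomputable def restrictedCoordMul {n : ℕ} (S : Submodule ℂ (BergmanSpace n))
    (hinv : ∀ i, ∀ f ∈ S, coordMul i f ∈ S) (i : Fin n) : S →L[ℂ] S :=
  (coordMul i).restrict (hinv i)

end BergmanPolydisc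

open BergmanPolydisc

/-! The engine is Shimorin's inequality ‖Tx + y‖² ≤ 2(‖x‖² + ‖Ty‖²). It holds for every coordinate
multiplication on the Bergman space and is inherited by restrictions to invariant subspaces. By
`adjoint_concave` it makes m ↦ ‖T*ᵐ f‖² concave whenever f is orthogonal to all Tˡ ker T*. A
nonnegative concave sequence cannot decrease, so ‖f‖ ≤ ‖T*f‖; as T strictly shrinks nonzero vectors,
this forces f = 0. Hence ker T* generates the space under T.

For several operators the one-operator result is proved relative to a closed reducing subspace K
(`reducing_le_closure_span`). Double commutation makes K ∩ ker T₀* reducing for the remaining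
operators, so induction on their number gives density of the span. Orthogonality needs only
commutativity: a nontrivial monomial has range inside the range of some Tᵢ.

The inequality itself is a computation with Taylor coefficients on the disc, where zᵏ has squared
norm proportional to 1/(k+1). It reduces to Cauchy–Schwarz for the consecutive weights k+1, k+2,
k+3. Fubini carries it to the polydisc, one coordinate at a time. -/

namespace BergmanPolydisc

/-! ### Concave sequences and monomials in commuting operators -/

/-- A sequence of nonnegative reals with nonincreasing increments is nondecreasing at the start. -/
lemma le_of_concave_seq {a : ℕ → ℝ} (h0 : ∀ m, 0 ≤ a m)
    (hc : ∀ m, a (m + 2) + a m ≤ 2 * a (m + 1)) : a 0 ≤ a 1 := by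
  by_contra! hlt
  have hstep : ∀ m, a (m + 1) - a m ≤ a 1 - a 0 := by
    intro m
    induction m with
    | zero => simp
    | succ m ih => linarith [hc m]
  have hlin : ∀ m : ℕ, a m ≤ a 0 + m * (a 1 - a 0) := by
    intro m
    induction m with
    | zero => simp
    | succ m ih => push_cast; linarith [hstep m]
  -- Beyond this index the linear upper bound is negative.
  obtain ⟨m, hm⟩ := exists_nat_gt (a 0 / (a 0 - a 1))
  rw [div_lt_iff₀ (by linarith)] at hm
  linarith [h0 m, hlin m]

/-- Commutativity moves one factor `T i` to the far left of the product. This yields the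
orthogonality half of the wandering property. -/
lemma monomialOp_mem_range {H : Type*} [NormedAddCommGroup H] [InnerProductSpace ℂ H] {k : ℕ} (T : Fin k → H →L[ℂ] H)
    (hcomm : ∀ i j, T i ∘L T j = T j ∘L T i) (l : Fin k → ℕ) (i : Fin k) (hi : l i ≠ 0) (x : H) :
    monomialOp T l x ∈ (T i).range := by
  suffices h : ∃ B, monomialOp T l = T i * B by
    obtain ⟨B, hB⟩ := h
    exact ⟨B x, by rw [hB]; rfl⟩
  induction k with
  | zero => exact i.elim0
  | succ k ih =>
    have hd : monomialOp T l = T 0 ^ l 0 * monomialOp (fun j => T j.succ) (fun j => l j.succ) := by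
      simp [monomialOp, List.ofFn_succ]
    rw [hd]
    induction i using Fin.cases with
    | zero =>
      obtain ⟨m, hm⟩ := Nat.exists_eq_succ_of_ne_zero hi
      exact ⟨T 0 ^ m * _, by rw [hm, pow_succ', mul_assoc]⟩
    | succ j =>
      obtain ⟨B, hB⟩ := ih (fun j => T j.succ) (fun _ _ => hcomm _ _) (fun j => l j.succ) j hi
      have hc : Commute (T 0 ^ l 0) (T j.succ) := Commute.pow_left (hcomm 0 j.succ) _
      exact ⟨T 0 ^ l 0 * B, by rw [hB, ← mul_assoc, hc.eq, mul_assoc]⟩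

/-! ### Shimorin's wandering subspace theorem for doubly commuting tuples -/

section Operators

variable {H : Type*} [NormedAddCommGroup H] [InnerProductSpace ℂ H] [CompleteSpace H]

/-- Shimorin's operator inequality yields concavity of the adjoint on the closure of the range. -/
lemma adjoint_concave {T : H →L[ℂ] H}
    (hT : ∀ x y, ‖T x + y‖ ^ 2 ≤ 2 * (‖x‖ ^ 2 + ‖T y‖ ^ 2)) {f : H}
    (hf : f ∈ T.range.topologicalClosure) :
    ‖T.adjoint (T.adjoint f)‖ ^ 2 + ‖f‖ ^ 2 ≤ 2 * ‖T.adjoint f‖ ^ 2 := by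
  have hcl : IsClosed {f : H |
      ‖T.adjoint (T.adjoint f)‖ ^ 2 + ‖f‖ ^ 2 ≤ 2 * ‖T.adjoint f‖ ^ 2} :=
    isClosed_le (by fun_prop) (by fun_prop)
  refine closure_minimal ?_ hcl hf
  rintro _ ⟨v, rfl⟩
  change ‖T.adjoint (T.adjoint (T v))‖ ^ 2 + ‖T v‖ ^ 2 ≤ 2 * ‖T.adjoint (T v)‖ ^ 2
  set u := T.adjoint (T v) with hu
  -- With s = ‖T*u‖² + ‖Tv‖², this pairing equals s, while `hT` at x = T*u, y = v bounds ‖TT*u + v‖²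
  -- by 2s. Cauchy–Schwarz then gives s² ≤ 2s‖u‖², and s cancels.
  have hin : ⟪T (T.adjoint u) + v, u⟫_ℂ = ((‖T.adjoint u‖ ^ 2 + ‖T v‖ ^ 2 : ℝ) : ℂ) := by
    rw [inner_add_left, ← ContinuousLinearMap.adjoint_inner_right, inner_self_eq_norm_sq_to_K]
    nth_rw 3 [hu]
    rw [ContinuousLinearMap.adjoint_inner_right, inner_self_eq_norm_sq_to_K]
    push_cast
    rfl
  have hcs := norm_inner_le_norm (𝕜 := ℂ) (T (T.adjoint u) + v) u
  rw [hin, Complex.norm_real, Real.norm_of_nonneg (by positivity)] at hcs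
  have hsq := hT (T.adjoint u) v
  set s := ‖T.adjoint u‖ ^ 2 + ‖T v‖ ^ 2
  have hs : 0 ≤ s := by positivity
  rcases hs.eq_or_lt with h | h
  · rw [← h]; positivity
  · have h1 : s ^ 2 ≤ (2 * s) * ‖u‖ ^ 2 := by
      calc s ^ 2 ≤ (‖T (T.adjoint u) + v‖ * ‖u‖) ^ 2 := by gcongr
        _ = ‖T (T.adjoint u) + v‖ ^ 2 * ‖u‖ ^ 2 := by ring
        _ ≤ _ := by gcongr
    have h2 : s * s ≤ s * (2 * ‖u‖ ^ 2) := by linarith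
    exact le_of_mul_le_mul_left h2 h

/-- The wandering subspace property of an operator satisfying Shimorin's inequality, relative to
a reducing subspace `K`. -/
lemma reducing_le_closure_span {T : H →L[ℂ] H}
    (hT : ∀ x y, ‖T x + y‖ ^ 2 ≤ 2 * (‖x‖ ^ 2 + ‖T y‖ ^ 2))
    (hs : ∀ x, x ≠ 0 → ‖T x‖ < ‖x‖) {K : Submodule ℂ H} (hK : IsClosed (K : Set H))
    (hKT : ∀ x ∈ K, T x ∈ K) (hKT' : ∀ x ∈ K, T.adjoint x ∈ K) :
    K ≤ (Submodule.span ℂ {v | ∃ l : ℕ, ∃ h ∈ K, T.adjoint h = 0 ∧ v = (T ^ l) h}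
      ).topologicalClosure := by
  set N := (Submodule.span ℂ {v | ∃ l : ℕ, ∃ h ∈ K, T.adjoint h = 0 ∧ v = (T ^ l) h}
      ).topologicalClosure
  have : CompleteSpace K := hK.completeSpace_coe
  have : CompleteSpace N := (Submodule.isClosed_topologicalClosure _).completeSpace_coe
  have hpow : ∀ l, ∀ h ∈ K, (T ^ l) h ∈ K := by
    intro l h hh
    induction l with
    | zero => simpa
    | succ l ih => rw [pow_succ']; exact hKT _ ih
  have hNK : N ≤ K := by
    refine Submodule.topologicalClosure_minimal _ (Submodule.span_le.2 ?_) hK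
    rintro _ ⟨l, h, hh, -, rfl⟩
    exact hpow l h hh
  have hmemN : ∀ l, ∀ h ∈ K, T.adjoint h = 0 → (T ^ l) h ∈ N := fun l h hh h0 =>
    Submodule.le_topologicalClosure _ (Submodule.subset_span ⟨l, h, hh, h0, rfl⟩)
  have horth : ∀ f, (∀ l, ∀ h ∈ K, T.adjoint h = 0 → ⟪(T ^ l) h, f⟫_ℂ = 0) → f ∈ K → f = 0 := by
    intro f hf hfK
    -- Orthogonality to every Tˡh survives applying T*, which merely raises l by one.
    have hM : ∀ m : ℕ, ((T.adjoint ^ m) f ∈ K) ∧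
        ∀ l, ∀ h ∈ K, T.adjoint h = 0 → ⟪(T ^ l) h, (T.adjoint ^ m) f⟫_ℂ = 0 := by
      intro m
      induction m with
      | zero => exact ⟨by simpa using hfK, fun l h hh h0 => hf l h hh h0⟩
      | succ m ih =>
        rw [pow_succ']
        refine ⟨hKT' _ ih.1, fun l h hh h0 => ?_⟩
        have := ih.2 (l + 1) h hh h0
        rw [pow_succ'] at this
        rw [mul_apply_eq_comp, ContinuousLinearMap.adjoint_inner_right]
        exact this
    -- The closure of the range is (ker T*)ᗮ. Since K is reducing, the K-component of a vector of
    -- ker T* is again in ker T*, so testing against K ∩ ker T* suffices.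
    have hran : ∀ g ∈ K, (∀ h ∈ K, T.adjoint h = 0 → ⟪h, g⟫_ℂ = 0) →
        g ∈ T.range.topologicalClosure := by
      intro g hgK hg
      rw [← Submodule.orthogonal_orthogonal_eq_closure, Submodule.mem_orthogonal]
      intro e he
      have he0 : T.adjoint e = 0 := by
        refine ext_inner_right ℂ fun x => ?_
        rw [ContinuousLinearMap.adjoint_inner_left, inner_zero_left, ← inner_conj_symm,
          (Submodule.mem_orthogonal _ _).1 he (T x) ⟨x, rfl⟩, map_zero]
      obtain ⟨p, hp, q, hq, rfl⟩ := K.exists_add_mem_mem_orthogonal e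
      have hTp : T.adjoint p = 0 := by
        have hq' : T.adjoint q ∈ Kᗮ := by
          rw [Submodule.mem_orthogonal]
          intro x hx
          rw [ContinuousLinearMap.adjoint_inner_right]
          exact (Submodule.mem_orthogonal _ _).1 hq _ (hKT x hx)
        have hpq : T.adjoint p = -T.adjoint q := by
          rw [map_add] at he0; exact eq_neg_of_add_eq_zero_left he0
        have hpo : T.adjoint p ∈ Kᗮ := hpq ▸ Submodule.neg_mem _ hq'
        exact inner_self_eq_zero.1 ((Submodule.mem_orthogonal _ _).1 hpo _ (hKT' p hp))
      rw [inner_add_left, hg p hp hTp, (Submodule.mem_orthogonal' _ _).1 hq g hgK, add_zero]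
    have hcon := le_of_concave_seq (a := fun m => ‖(T.adjoint ^ m) f‖ ^ 2)
      (fun m => by positivity) (fun m => by
        have h1 := adjoint_concave hT (hran _ (hM m).1 fun h hh h0 => (hM m).2 0 h hh h0)
        rw [show m + 2 = m + 1 + 1 from rfl, pow_succ' T.adjoint (m + 1), pow_succ' T.adjoint m]
        exact h1)
    simp only [pow_zero, pow_one, one_apply_eq_self] at hcon
    have hle : ‖f‖ ≤ ‖T.adjoint f‖ := by
      exact (sq_le_sq₀ (norm_nonneg _) (norm_nonneg _)).1 hcon
    -- If T*f ≠ 0, then ‖T*f‖² = ⟪TT*f, f⟫ ≤ ‖TT*f‖‖f‖ < ‖T*f‖‖f‖, contradicting ‖f‖ ≤ ‖T*f‖.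
    have h0 : T.adjoint f = 0 := by
      by_contra hne
      have h1 := hs _ hne
      have h2 : ‖T.adjoint f‖ ^ 2 ≤ ‖T (T.adjoint f)‖ * ‖f‖ := by
        have := norm_inner_le_norm (𝕜 := ℂ) (T (T.adjoint f)) f
        rw [← ContinuousLinearMap.adjoint_inner_right, inner_self_eq_norm_sq_to_K] at this
        simpa using this
      have h3 : 0 < ‖T.adjoint f‖ := norm_pos_iff.2 hne
      nlinarith [norm_nonneg (T (T.adjoint f)), norm_nonneg f]
    rw [h0, norm_zero] at hle
    exact norm_le_zero_iff.1 hle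
  intro x hx
  obtain ⟨p, hp, q, hq, rfl⟩ := N.exists_add_mem_mem_orthogonal x
  have hqK : q ∈ K := by simpa using K.sub_mem hx (hNK hp)
  have : q = 0 := horth q (fun l h hh h0 =>
    (Submodule.mem_orthogonal _ _).1 hq _ (hmemN l h hh h0)) hqK
  simpa [this] using hp

/-- Induction on the number of operators, with K varying: the step peels off `T 0` and applies the
hypothesis to K ∩ ker T₀*. That space is invariant under the other operators by double commutation,
and under their adjoints by commutativity. -/
lemma reducing_le_closure_span_monomialOp {k : ℕ} (T : Fin k → H →L[ℂ] H)
    (hT : ∀ i x y, ‖T i x + y‖ ^ 2 ≤ 2 * (‖x‖ ^ 2 + ‖T i y‖ ^ 2))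
    (hs : ∀ i x, x ≠ 0 → ‖T i x‖ < ‖x‖)
    (hcomm : ∀ i j, T i ∘L T j = T j ∘L T i)
    (hdc : ∀ i j, i ≠ j → T i ∘L (T j).adjoint = (T j).adjoint ∘L T i)
    {K : Submodule ℂ H} (hK : IsClosed (K : Set H))
    (hKT : ∀ i, ∀ x ∈ K, T i x ∈ K) (hKT' : ∀ i, ∀ x ∈ K, (T i).adjoint x ∈ K) :
    K ≤ (Submodule.span ℂ {v | ∃ l : Fin k → ℕ, ∃ h ∈ K, (∀ i, (T i).adjoint h = 0) ∧
      v = monomialOp T l h}).topologicalClosure := by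
  induction k generalizing K with
  | zero =>
    intro x hx
    exact Submodule.le_topologicalClosure _
      (Submodule.subset_span ⟨0, x, hx, fun i => i.elim0, by simp [monomialOp]⟩)
  | succ k ih =>
    set N := (Submodule.span ℂ {v | ∃ l : Fin (k + 1) → ℕ, ∃ h ∈ K,
      (∀ i, (T i).adjoint h = 0) ∧ v = monomialOp T l h}).topologicalClosure
    have hNc : IsClosed (N : Set H) := Submodule.isClosed_topologicalClosure _
    set K' : Submodule ℂ H := K ⊓ ((T 0).adjoint).ker
    have hK' : IsClosed (K' : Set H) := hK.inter (T 0).adjoint.isClosed_ker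
    have h2 := ih (fun i => T i.succ) (fun i => hT _) (fun i => hs _) (fun i j => hcomm _ _)
      (fun i j hij => hdc _ _ (by simpa using hij)) hK'
      (fun i x hx => ⟨hKT _ x hx.1, by
        have := DFunLike.congr_fun (hdc i.succ 0 (Fin.succ_ne_zero i)) x
        simp only [ContinuousLinearMap.comp_apply] at this
        have hx0 : (T 0).adjoint x = 0 := hx.2
        change (T 0).adjoint (T i.succ x) = 0
        rw [← this, hx0, map_zero]⟩)
      (fun i x hx => ⟨hKT' _ x hx.1, by
        have h := congrArg ContinuousLinearMap.adjoint (hcomm 0 i.succ)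
        rw [ContinuousLinearMap.adjoint_comp, ContinuousLinearMap.adjoint_comp] at h
        have := DFunLike.congr_fun h x
        simp only [ContinuousLinearMap.comp_apply] at this
        have hx0 : (T 0).adjoint x = 0 := hx.2
        change (T 0).adjoint ((T i.succ).adjoint x) = 0
        rw [← this, hx0, map_zero]⟩)
    refine (reducing_le_closure_span (hT 0) (hs 0) hK (hKT 0) (hKT' 0)).trans
      (Submodule.topologicalClosure_minimal _ (Submodule.span_le.2 ?_) hNc)
    rintro _ ⟨l, h, hh, h0, rfl⟩
    -- The vectors sent into N by T₀ˡ form a closed subspace, so it is enough to check the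
    -- generators of K ∩ ker T₀*.
    have hcl : IsClosed ((N.comap ((T 0) ^ l).toLinearMap : Submodule ℂ H) : Set H) :=
      hNc.preimage ((T 0) ^ l).continuous
    refine Submodule.topologicalClosure_minimal _ (Submodule.span_le.2 ?_) hcl (h2 ⟨hh, h0⟩)
    rintro _ ⟨l', h', hh', h0', rfl⟩
    refine Submodule.le_topologicalClosure _ (Submodule.subset_span
      ⟨Fin.cons l l', h', hh'.1, Fin.cases hh'.2 h0', ?_⟩)
    simp only [monomialOp, List.ofFn_succ, Fin.cons_zero, Fin.cons_succ, List.prod_cons]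
    rfl

/-- A doubly commuting tuple of strict contractions satisfying Shimorin's inequality has its defect
space as wandering subspace. -/
theorem isWanderingSubspace_defectSpace {k : ℕ} (T : Fin k → H →L[ℂ] H)
    (hT : ∀ i x y, ‖T i x + y‖ ^ 2 ≤ 2 * (‖x‖ ^ 2 + ‖T i y‖ ^ 2))
    (hs : ∀ i x, x ≠ 0 → ‖T i x‖ < ‖x‖)
    (hcomm : ∀ i j, T i ∘L T j = T j ∘L T i)
    (hdc : ∀ i j, i ≠ j → T i ∘L (T j).adjoint = (T j).adjoint ∘L T i) :
    IsWanderingSubspace T (defectSpace T) := by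
  refine ⟨?_, fun l hl => ?_, ?_⟩
  · rw [defectSpace, Submodule.coe_iInf]
    exact isClosed_iInter fun j => Submodule.isClosed_orthogonal _
  · obtain ⟨i, hi⟩ := Function.ne_iff.1 hl
    rw [Submodule.isOrtho_iff_inner_eq]
    rintro u hu _ ⟨v, -, rfl⟩
    exact (Submodule.mem_orthogonal' _ _).1 ((Submodule.mem_iInf _).1 hu i) _
      (monomialOp_mem_range T hcomm l i hi v)
  · rw [eq_top_iff]
    refine (reducing_le_closure_span_monomialOp T hT hs hcomm hdc (K := ⊤) isClosed_univ
      (by simp) (by simp)).trans (Submodule.topologicalClosure_mono (Submodule.span_mono ?_))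
    rintro _ ⟨l, h, -, h0, rfl⟩
    refine ⟨l, h, (Submodule.mem_iInf _).2 fun j => ?_, rfl⟩
    rw [Submodule.mem_orthogonal]
    rintro _ ⟨x, rfl⟩
    change ⟪T j x, h⟫_ℂ = 0
    rw [← ContinuousLinearMap.adjoint_inner_right, h0, inner_zero_right]

end Operators
-- Power series and Shimorin's inequality on the disc
/-- **Parseval's identity** for absolutely convergent power series on the unit circle. -/
lemma hasSum_sq_norm_circleAverage {c : ℕ → ℂ} (hc : Summable fun k => ‖c k‖) {F : ℂ → ℂ}
    (hF : ∀ z, ‖z‖ = 1 → HasSum (fun k => c k * z ^ k) (F z)) :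
    HasSum (fun k => ‖c k‖ ^ 2) (Real.circleAverage (fun z => ‖F z‖ ^ 2) 0 1) := by
  have hb : ∀ z : ℂ, ‖z‖ = 1 → ∀ s : Finset ℕ,
      ‖∑ k ∈ s, c k * z ^ k‖ ≤ ∑' k, ‖c k‖ := fun z hz s =>
    (norm_sum_le _ _).trans (by
      simp only [norm_mul, norm_pow, hz, one_pow, mul_one]
      exact hc.sum_le_tsum _ fun _ _ => norm_nonneg _)
  have hpars : ∀ s : Finset ℕ, ∑ k ∈ s, ‖c k‖ ^ 2
      = Real.circleAverage (fun z => ‖∑ k ∈ s, c k * z ^ k‖ ^ 2) 0 1 := by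
    intro s
    have h := (∑ k ∈ s, Polynomial.monomial k (c k)).sum_sq_norm_coeff_eq_circleAverage
    simp only [Polynomial.eval_finsetSum, Polynomial.eval_monomial] at h
    rw [← h, eq_comm]
    -- The polynomial identity sums over the support, which is smaller than `s` when some
    -- coefficients vanish.
    refine Finset.sum_subset_zero_on_sdiff (fun k hk => ?_) (fun k hk => ?_) fun k hk => ?_
    · by_contra hks
      refine Polynomial.mem_support_iff.1 hk ?_
      simp [Polynomial.coeff_monomial, hks]
    · rw [Finset.mem_sdiff, Polynomial.notMem_support_iff] at hk
      have h1 := hk.2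
      simp only [Polynomial.finsetSum_coeff, Polynomial.coeff_monomial,
        Finset.sum_ite_eq', hk.1, if_true] at h1
      simp [h1]
    · have : k ∈ s := by
        by_contra hks
        refine Polynomial.mem_support_iff.1 hk ?_
        simp [Polynomial.coeff_monomial, hks]
      simp [Polynomial.coeff_monomial, this]
  have hn : ∀ θ, ‖circleMap 0 1 θ‖ = 1 := fun θ => by simp
  rw [HasSum]
  simp_rw [SummationFilter.unconditional_filter, hpars, Real.circleAverage_def]
  refine Tendsto.const_smul ?_ _
  refine intervalIntegral.tendsto_integral_filter_of_dominated_convergence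
    (fun _ => (∑' k, ‖c k‖) ^ 2) (Eventually.of_forall fun s => ?_)
    (Eventually.of_forall fun s => Eventually.of_forall fun θ _ => ?_)
    intervalIntegrable_const (Eventually.of_forall fun θ _ => ?_)
  · exact Continuous.aestronglyMeasurable (by fun_prop)
  · rw [norm_pow, norm_norm]
    exact pow_le_pow_left₀ (norm_nonneg _) (hb _ (hn θ) s) 2
  · exact ((hF _ (hn θ)).norm.pow 2 :)

/-- The energy of a power series on a circle of radius `r < 1`. -/
lemma lintegral_circle_sq_enorm {a : ℕ → ℂ} {f : ℂ → ℂ} (hcont : ContinuousOn f (ball 0 1))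
    (hf : ∀ z ∈ ball (0 : ℂ) 1, HasSum (fun k => a k * z ^ k) (f z)) {r : ℝ}
    (hr : r ∈ Set.Ioo (0 : ℝ) 1) :
    ∫⁻ θ in Set.Ioo (-Real.pi) Real.pi, ‖f (Complex.polarCoord.symm (r, θ))‖ₑ ^ 2
      = ∑' k, ENNReal.ofReal (2 * Real.pi * ‖a k‖ ^ 2 * r ^ (2 * k)) := by
  have hr0 : 0 < r := hr.1
  have hmem : ∀ z : ℂ, ‖z‖ = 1 → (r : ℂ) * z ∈ ball (0 : ℂ) 1 := by
    intro z hz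
    simp [hz, abs_of_pos hr0, hr.2]
  have hsum : Summable fun k => ‖a k * (r : ℂ) ^ k‖ := by
    have := (hf _ (hmem 1 (by simp))).summable.norm
    simpa using this
  have h1 := hasSum_sq_norm_circleAverage (c := fun k => a k * (r : ℂ) ^ k) hsum
    (F := fun z => f (r * z)) (fun z hz => by
      have := hf _ (hmem z hz)
      simpa only [mul_pow, mul_assoc] using this)
  have hpol : ∀ θ : ℝ, Complex.polarCoord.symm (r, θ) = (r : ℂ) * circleMap 0 1 θ := by
    intro θ
    rw [Complex.polarCoord_symm_apply, circleMap_zero, Complex.exp_mul_I]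
    simp
  have hcc : Continuous fun θ : ℝ => ‖f ((r : ℂ) * circleMap 0 1 θ)‖ ^ 2 := by
    have : Continuous fun θ : ℝ => f ((r : ℂ) * circleMap 0 1 θ) :=
      hcont.comp_continuous (by fun_prop) fun θ => hmem _ (by simp)
    exact this.norm.pow 2
  -- Polar coordinates use the angles (-π, π), the circle average uses (0, 2π); periodicity
  -- reconciles them.
  have hper : Function.Periodic (fun θ : ℝ => ‖f ((r : ℂ) * circleMap 0 1 θ)‖ ^ 2)
      (2 * Real.pi) := fun θ => by simp only [periodic_circleMap 0 1 θ]
  have h2 : ∫ θ in Set.Ioo (-Real.pi) Real.pi, ‖f ((r : ℂ) * circleMap 0 1 θ)‖ ^ 2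
      = 2 * Real.pi * Real.circleAverage (fun z => ‖f (r * z)‖ ^ 2) 0 1 := by
    rw [Real.circleAverage_def, smul_eq_mul, ← mul_assoc, mul_inv_cancel₀ (by positivity), one_mul,
      ← integral_Ioc_eq_integral_Ioo,
      ← intervalIntegral.integral_of_le (by linarith [Real.pi_pos])]
    have := hper.intervalIntegral_add_eq (-Real.pi) 0
    rw [zero_add, show -Real.pi + 2 * Real.pi = Real.pi by ring] at this
    exact this
  have h3 : HasSum (fun k => 2 * Real.pi * ‖a k‖ ^ 2 * r ^ (2 * k))
      (∫ θ in Set.Ioo (-Real.pi) Real.pi, ‖f ((r : ℂ) * circleMap 0 1 θ)‖ ^ 2) := by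
    rw [h2]
    refine (h1.mul_left (2 * Real.pi)).congr_fun ?_ |> id
    intro k
    rw [norm_mul, norm_pow, Complex.norm_real, Real.norm_of_nonneg hr0.le]
    ring
  simp_rw [hpol]
  rw [← ENNReal.ofReal_tsum_of_nonneg (fun k => by positivity) h3.summable, h3.tsum_eq,
    ofReal_integral_eq_lintegral_ofReal]
  · refine lintegral_congr fun θ => ?_
    rw [ENNReal.ofReal_pow (norm_nonneg _), ofReal_norm]
  · exact (hcc.integrableOn_Icc).mono_set Set.Ioo_subset_Icc_self
  · exact ae_of_all _ fun θ => by positivity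

/-- The area integral of `|f|²` over the unit disc in terms of the power series of `f`. -/
lemma lintegral_ball_sq_enorm {a : ℕ → ℂ} {f : ℂ → ℂ} (hcont : ContinuousOn f (ball 0 1))
    (hf : ∀ z ∈ ball (0 : ℂ) 1, HasSum (fun k => a k * z ^ k) (f z)) :
    ∫⁻ z in ball 0 1, ‖f z‖ₑ ^ 2
      = ∑' k : ℕ, ENNReal.ofReal (Real.pi * ‖a k‖ ^ 2 / (k + 1)) := by
  have hmem : ∀ p ∈ Set.Ioo (0 : ℝ) 1 ×ˢ Set.Ioo (-Real.pi) Real.pi,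
      Complex.polarCoord.symm p ∈ ball (0 : ℂ) 1 := by
    rintro p ⟨hp, -⟩
    rw [mem_ball_zero_iff, Complex.norm_polarCoord_symm, abs_of_pos hp.1]
    exact hp.2
  rw [← lintegral_indicator measurableSet_ball, ← Complex.lintegral_comp_polarCoord_symm]
  have hms : MeasurableSet (Set.Ioo (0 : ℝ) 1 ×ˢ Set.Ioo (-Real.pi) Real.pi) :=
    measurableSet_Ioo.prod measurableSet_Ioo
  have hsub : Set.Ioo (0 : ℝ) 1 ×ˢ Set.Ioo (-Real.pi) Real.pi ⊆ polarCoord.target :=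
    Set.prod_mono Set.Ioo_subset_Ioi_self subset_rfl
  have hind : ∫⁻ p in polarCoord.target, ENNReal.ofReal p.1 •
        (ball (0 : ℂ) 1).indicator (fun z => ‖f z‖ₑ ^ 2) (Complex.polarCoord.symm p)
      = ∫⁻ p in Set.Ioo (0 : ℝ) 1 ×ˢ Set.Ioo (-Real.pi) Real.pi,
        ENNReal.ofReal p.1 * ‖f (Complex.polarCoord.symm p)‖ₑ ^ 2 := by
    rw [← lintegral_indicator polarCoord.open_target.measurableSet, ← lintegral_indicator hms]
    refine lintegral_congr fun p => ?_
    by_cases hp : p ∈ Set.Ioo (0 : ℝ) 1 ×ˢ Set.Ioo (-Real.pi) Real.pi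
    · rw [Set.indicator_of_mem hp, Set.indicator_of_mem (hsub hp),
        Set.indicator_of_mem (hmem p hp), smul_eq_mul]
    · rw [Set.indicator_of_notMem hp]
      by_cases hp' : p ∈ polarCoord.target
      · rw [Set.indicator_of_mem hp', Set.indicator_of_notMem, smul_zero]
        rw [mem_ball_zero_iff, Complex.norm_polarCoord_symm, abs_of_pos hp'.1]
        exact fun h => hp ⟨⟨hp'.1, h⟩, hp'.2⟩
      · rw [Set.indicator_of_notMem hp']
  have hcp : ContinuousOn (fun p => f (Complex.polarCoord.symm p))
      (Set.Ioo (0 : ℝ) 1 ×ˢ Set.Ioo (-Real.pi) Real.pi) :=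
    hcont.comp (by
      have : Continuous fun p : ℝ × ℝ =>
          (p.1 : ℂ) * ((Real.cos p.2 : ℂ) + (Real.sin p.2 : ℂ) * Complex.I) := by fun_prop
      exact (this.congr fun p => (Complex.polarCoord_symm_apply p).symm).continuousOn) hmem
  rw [hind, Measure.volume_eq_prod, ← Measure.prod_restrict, lintegral_prod]
  · have hin : ∀ r ∈ Set.Ioo (0 : ℝ) 1,
        ∫⁻ θ in Set.Ioo (-Real.pi) Real.pi,
          ENNReal.ofReal r * ‖f (Complex.polarCoord.symm (r, θ))‖ₑ ^ 2
        = ∑' k : ℕ, ENNReal.ofReal (2 * Real.pi * ‖a k‖ ^ 2 * r ^ (2 * k + 1)) := by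
      intro r hr
      rw [lintegral_const_mul' _ _ ENNReal.ofReal_ne_top, lintegral_circle_sq_enorm hcont hf hr,
        ← ENNReal.tsum_mul_left]
      refine tsum_congr fun k => ?_
      rw [← ENNReal.ofReal_mul hr.1.le]
      ring_nf
    rw [setLIntegral_congr_fun measurableSet_Ioo hin, lintegral_tsum fun k => by fun_prop]
    refine tsum_congr fun k => ?_
    rw [← ofReal_integral_eq_lintegral_ofReal, ← integral_Ioc_eq_integral_Ioo,
      ← intervalIntegral.integral_of_le zero_le_one, intervalIntegral.integral_const_mul,
      integral_pow]
    · congr 1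
      push_cast
      field_simp
      simp
      ring
    · exact (Continuous.integrableOn_Icc (by fun_prop)).mono_set Set.Ioo_subset_Icc_self
    · filter_upwards [ae_restrict_mem measurableSet_Ioo] with r hr
      have := hr.1
      positivity
  · rw [Measure.prod_restrict]
    exact (ENNReal.measurable_ofReal.comp measurable_fst).aemeasurable.mul
      ((hcp.aemeasurable hms).enorm.pow_const 2)

/-- The coefficient sequence of `z * h z` for a power series `h`. -/
def shiftCoeff (a : ℕ → ℂ) : ℕ → ℂ
  | 0 => 0
  | k + 1 => a k

/-- The weighted Cauchy–Schwarz inequality between consecutive Bergman weights. -/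
lemma bergman_weight_ineq (a b : ℂ) (k : ℕ) :
    ‖a + b‖ ^ 2 / (k + 2 : ℝ) ≤ 2 * (‖a‖ ^ 2 / (k + 1) + ‖b‖ ^ 2 / (k + 3)) := by
  have h1 : ‖a + b‖ ^ 2 ≤ (‖a‖ + ‖b‖) ^ 2 := by gcongr; exact norm_add_le a b
  have hk : (0 : ℝ) ≤ k := k.cast_nonneg
  refine (div_le_div_of_nonneg_right h1 (by positivity)).trans ?_
  rw [← sub_nonneg]
  -- This is the defect in Cauchy–Schwarz with weights k+1 and k+3, whose sum is 2(k+2).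
  have : 2 * (‖a‖ ^ 2 / (k + 1 : ℝ) + ‖b‖ ^ 2 / (k + 3)) - (‖a‖ + ‖b‖) ^ 2 / (k + 2)
      = ((k + 3) * ‖a‖ - (k + 1) * ‖b‖) ^ 2 / ((k + 1) * (k + 2) * (k + 3)) := by
    field_simp
    ring
  rw [this]
  positivity

/-- **Shimorin's inequality** on the unit disc. -/
lemma lintegral_ball_mul_add_le {f g : ℂ → ℂ} (hf : DifferentiableOn ℂ f (ball 0 1))
    (hg : DifferentiableOn ℂ g (ball 0 1)) :
    ∫⁻ z in ball 0 1, ‖z * f z + g z‖ₑ ^ 2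
      ≤ ∫⁻ z in ball 0 1, 2 * (‖f z‖ₑ ^ 2 + ‖z * g z‖ₑ ^ 2) := by
  have hexp : ∀ {h : ℂ → ℂ}, DifferentiableOn ℂ h (ball 0 1) →
      ∃ a : ℕ → ℂ, ∀ z ∈ ball (0 : ℂ) 1, HasSum (fun k => a k * z ^ k) (h z) := by
    intro h hh
    refine ⟨fun k => (k.factorial : ℂ)⁻¹ * iteratedDeriv k h 0, fun z hz => ?_⟩
    refine (Complex.hasSum_taylorSeries_on_ball hh hz).congr_fun fun k => ?_
    simp only [sub_zero, smul_eq_mul]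
    ring
  have hshift : ∀ {h : ℂ → ℂ} {a : ℕ → ℂ},
      (∀ z ∈ ball (0 : ℂ) 1, HasSum (fun k => a k * z ^ k) (h z)) →
      ∀ z ∈ ball (0 : ℂ) 1,
        HasSum (fun k => shiftCoeff a k * z ^ k) (z * h z) := by
    intro h a ha z hz
    rw [← hasSum_nat_add_iff' 1]
    simp only [shiftCoeff, Finset.range_one, Finset.sum_singleton, zero_mul, sub_zero]
    refine ((ha z hz).mul_left z).congr_fun fun k => ?_
    ring
  obtain ⟨a, ha⟩ := hexp hf
  obtain ⟨b, hb⟩ := hexp hg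
  have hza := hshift ha
  have hzb := hshift hb
  have hs : ∀ z ∈ ball (0 : ℂ) 1,
      HasSum (fun k => (shiftCoeff a k + b k) * z ^ k) (z * f z + g z) := by
    intro z hz
    refine ((hza z hz).add (hb z hz)).congr_fun fun k => ?_
    ring
  have hcf := hf.continuousOn
  have hcg := hg.continuousOn
  have hmf : AEMeasurable (fun z => ‖f z‖ₑ ^ 2) (volume.restrict (ball 0 1)) :=
    (hcf.aemeasurable measurableSet_ball).enorm.pow_const 2
  -- Degree k+1 of zf + g is to be compared with degree k of f and degree k+2 of zg. So one term is
  -- split off on the left and two from the series of zg.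
  rw [lintegral_const_mul' _ _ (by simp), lintegral_add_left' hmf,
    lintegral_ball_sq_enorm (by fun_prop) hs, lintegral_ball_sq_enorm hcf ha,
    lintegral_ball_sq_enorm (by fun_prop) hzb,
    tsum_eq_zero_add' ENNReal.summable, tsum_eq_zero_add' (f := fun k : ℕ =>
      ENNReal.ofReal (Real.pi * ‖shiftCoeff b k‖ ^ 2 / (k + 1))) ENNReal.summable,
    tsum_eq_zero_add' (f := fun k : ℕ =>
      ENNReal.ofReal (Real.pi * ‖shiftCoeff b (k + 1)‖ ^ 2 / ((k + 1 : ℕ) + 1))) ENNReal.summable]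
  simp only [shiftCoeff, zero_add]
  rw [add_left_comm (∑' k : ℕ, ENNReal.ofReal (Real.pi * ‖a k‖ ^ 2 / (k + 1))),
    add_left_comm (∑' k : ℕ, ENNReal.ofReal (Real.pi * ‖a k‖ ^ 2 / (k + 1))),
    ← ENNReal.tsum_add, ← add_assoc, mul_add]
  refine add_le_add ?_ ?_
  -- The split-off terms agree: π‖b₀‖² on the left, and 2 · π‖b₀‖²/2 from degree 1 of zg on the
  -- right.
  · rw [← ENNReal.ofReal_add (by positivity) (by positivity), ← ENNReal.ofReal_ofNat 2,
      ← ENNReal.ofReal_mul (by norm_num)]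
    refine ENNReal.ofReal_le_ofReal (le_of_eq ?_)
    push_cast
    rw [norm_zero]
    ring
  · rw [← ENNReal.tsum_mul_left]
    refine ENNReal.tsum_le_tsum fun k => ?_
    rw [← ENNReal.ofReal_add (by positivity) (by positivity), ← ENNReal.ofReal_ofNat 2,
      ← ENNReal.ofReal_mul (by norm_num)]
    refine ENNReal.ofReal_le_ofReal ?_
    have := mul_le_mul_of_nonneg_left (bergman_weight_ineq (a k) (b (k + 1)) k) Real.pi_pos.le
    push_cast
    calc _ = Real.pi * (‖a k + b (k + 1)‖ ^ 2 / (k + 2 : ℝ)) := by ring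
      _ ≤ _ := this
      _ = _ := by ring

/-! ### Slicing: from the disc to the polydisc -/

lemma aemeasurable_polydiscMeasure_of_continuousOn {n : ℕ} {F : (Fin n → ℂ) → ℂ}
    (hF : ContinuousOn F (polydisc n)) : AEMeasurable F (polydiscMeasure n) := by
  rw [polydiscMeasure_eq]
  exact (hF.aemeasurable (isOpen_polydisc n).measurableSet).smul_measure _

lemma insertNth_mem_polydisc {m : ℕ} (i : Fin (m + 1)) {w : ℂ} {z : Fin m → ℂ}
    (hw : w ∈ ball (0 : ℂ) 1) (hz : z ∈ polydisc m) :
    i.insertNth (α := fun _ => ℂ) w z ∈ polydisc (m + 1) := by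
  intro j
  induction j using Fin.succAboveCases i with
  | x => simpa using hw
  | p j => simpa using hz j

lemma differentiableOn_slice {m : ℕ} (i : Fin (m + 1)) {F : (Fin (m + 1) → ℂ) → ℂ}
    (hF : DifferentiableOn ℂ F (polydisc (m + 1))) {z : Fin m → ℂ} (hz : z ∈ polydisc m) :
    DifferentiableOn ℂ (fun w => F (i.insertNth (α := fun _ => ℂ) w z)) (ball 0 1) := by
  refine hF.comp (fun w _ => ?_) fun w hw => insertNth_mem_polydisc i hw hz
  refine DifferentiableAt.differentiableWithinAt (differentiableAt_pi.2 fun j => ?_)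
  induction j using Fin.succAboveCases i with
  | x => simp
  | p j => simp

/-- **Shimorin's inequality** on the polydisc, in each coordinate. -/
lemma lintegral_polydisc_mul_add_le {n : ℕ} (i : Fin n) {F G : (Fin n → ℂ) → ℂ}
    (hF : DifferentiableOn ℂ F (polydisc n)) (hG : DifferentiableOn ℂ G (polydisc n)) :
    ∫⁻ z, ‖z i * F z + G z‖ₑ ^ 2 ∂(polydiscMeasure n)
      ≤ ∫⁻ z, 2 * (‖F z‖ₑ ^ 2 + ‖z i * G z‖ₑ ^ 2) ∂(polydiscMeasure n) := by
  cases n with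
  | zero => exact i.elim0
  | succ m =>
    have hp : MeasurePreserving (MeasurableEquiv.piFinSuccAbove (fun _ => ℂ) i).symm
        (discMeasure.prod (polydiscMeasure m)) (polydiscMeasure (m + 1)) :=
      (measurePreserving_piFinSuccAbove (fun _ => discMeasure) i).symm
    have hmF := aemeasurable_polydiscMeasure_of_continuousOn hF.continuousOn
    have hmG := aemeasurable_polydiscMeasure_of_continuousOn hG.continuousOn
    have hmz : AEMeasurable (fun z : Fin (m + 1) → ℂ => z i) (polydiscMeasure (m + 1)) :=
      (measurable_pi_apply i).aemeasurable
    have hL : AEMeasurable (fun z => ‖z i * F z + G z‖ₑ ^ 2) (polydiscMeasure (m + 1)) :=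
      ((hmz.mul hmF).add hmG).enorm.pow_const 2
    have hR : AEMeasurable (fun z => 2 * (‖F z‖ₑ ^ 2 + ‖z i * G z‖ₑ ^ 2))
        (polydiscMeasure (m + 1)) :=
      ((hmF.enorm.pow_const 2).add ((hmz.mul hmG).enorm.pow_const 2)).const_mul 2
    -- Fubini with the i-th coordinate innermost: on each slice z i is the disc variable and the
    -- other coordinates are parameters.
    have hfub : ∀ {φ : (Fin (m + 1) → ℂ) → ℝ≥0∞}, AEMeasurable φ (polydiscMeasure (m + 1)) →
        ∫⁻ z, φ z ∂(polydiscMeasure (m + 1)) = ∫⁻ z, ∫⁻ w, φ (i.insertNth (α := fun _ => ℂ) w z)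
          ∂discMeasure ∂(polydiscMeasure m) := by
      intro φ hφ
      rw [← hp.lintegral_comp_emb (MeasurableEquiv.measurableEmbedding _),
        lintegral_prod_symm]
      · rfl
      · exact hφ.comp_quasiMeasurePreserving hp.quasiMeasurePreserving
    rw [hfub hL, hfub hR]
    refine lintegral_mono_ae ?_
    filter_upwards [ae_mem_polydisc m] with z hz
    simp only [Fin.insertNth_apply_same, discMeasure, lintegral_smul_measure]
    refine smul_le_smul_of_nonneg_left ?_ zero_le
    exact lintegral_ball_mul_add_le (differentiableOn_slice i hF hz)
      (differentiableOn_slice i hG hz)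

/-! ### Norm estimates for coordinate multiplication -/

lemma enorm_sq_eq_lintegral {n : ℕ} (f : Lp ℂ 2 (polydiscMeasure n)) :
    ‖f‖ₑ ^ 2 = ∫⁻ z, ‖f z‖ₑ ^ 2 ∂(polydiscMeasure n) := by
  rw [Lp.enorm_def]
  have h := eLpNorm_nnreal_pow_eq_lintegral (μ := polydiscMeasure n) (f := f) (p := 2) (by norm_num)
  simpa using h

lemma coordMulLp_coeFn {n : ℕ} (i : Fin n) (f : Lp ℂ 2 (polydiscMeasure n)) :
    coordMulLp i f =ᵐ[polydiscMeasure n] fun z => z i * f z :=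
  (memLp_coord_mul i f).coeFn_toLp

lemma norm_coordMulLp_add_sq_le {n : ℕ} (i : Fin n) {f g : Lp ℂ 2 (polydiscMeasure n)}
    (hf : f ∈ bergman n) (hg : g ∈ bergman n) :
    ‖coordMulLp i f + g‖ ^ 2 ≤ 2 * (‖f‖ ^ 2 + ‖coordMulLp i g‖ ^ 2) := by
  obtain ⟨F, hF, hfF⟩ := hf
  obtain ⟨G, hG, hgG⟩ := hg
  have key : ‖coordMulLp i f + g‖ₑ ^ 2 ≤ 2 * (‖f‖ₑ ^ 2 + ‖coordMulLp i g‖ₑ ^ 2) := by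
    rw [enorm_sq_eq_lintegral, enorm_sq_eq_lintegral, enorm_sq_eq_lintegral,
      ← lintegral_add_left' ((Lp.aestronglyMeasurable f).enorm.pow_const 2),
      ← lintegral_const_mul' _ _ (by simp)]
    refine (le_of_eq (lintegral_congr_ae ?_)).trans
      ((lintegral_polydisc_mul_add_le i hF hG).trans (le_of_eq (lintegral_congr_ae ?_)))
    · filter_upwards [hfF, hgG, coordMulLp_coeFn i f, Lp.coeFn_add (coordMulLp i f) g]
        with z h1 h2 h3 h4
      rw [h4, Pi.add_apply, h3, h1, h2]
    · filter_upwards [hfF, hgG, coordMulLp_coeFn i g] with z h1 h2 h3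
      rw [h3, h1, h2]
  have := ENNReal.toReal_mono (by finiteness) key
  rw [ENNReal.toReal_mul, ENNReal.toReal_add (by finiteness) (by finiteness)] at this
  simpa using this

/-- Since |z i| < 1 throughout the polydisc, the integrand drops strictly wherever f ≠ 0. Holomorphy
plays no role. -/
lemma norm_coordMulLp_lt {n : ℕ} (i : Fin n) {f : Lp ℂ 2 (polydiscMeasure n)} (hf : f ≠ 0) :
    ‖coordMulLp i f‖ < ‖f‖ := by
  have key : ‖coordMulLp i f‖ₑ ^ 2 < ‖f‖ₑ ^ 2 := by
    rw [enorm_sq_eq_lintegral, enorm_sq_eq_lintegral]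
    refine lintegral_strict_mono_of_ae_le_of_frequently_ae_lt
      ((Lp.aestronglyMeasurable f).enorm.pow_const 2) ?_ ?_ ?_
    · rw [← enorm_sq_eq_lintegral]; finiteness
    · filter_upwards [coordMulLp_coeFn i f, ae_mem_polydisc n] with z h1 h2
      rw [h1, enorm_mul]
      gcongr
      refine mul_le_of_le_one_left zero_le ?_
      rw [← ofReal_norm]
      exact ENNReal.ofReal_le_one.2 (h2 i).le
    · intro hcon
      refine hf ((Lp.eq_zero_iff_ae_eq_zero).2 ?_)
      filter_upwards [hcon, coordMulLp_coeFn i f, ae_mem_polydisc n] with z h1 h2 h3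
      by_contra hne
      refine h1 ?_
      rw [h2, ← ofReal_norm, ← ofReal_norm, ← ENNReal.ofReal_pow (norm_nonneg _),
        ← ENNReal.ofReal_pow (norm_nonneg _)]
      have h0 : 0 < ‖f z‖ := norm_pos_iff.2 hne
      refine ((ENNReal.ofReal_lt_ofReal_iff (by positivity)).2 ?_).ne
      rw [norm_mul]
      gcongr
      exact mul_lt_of_lt_one_left h0 (h3 i)
  have h := ENNReal.toReal_strict_mono (by finiteness) key
  rw [ENNReal.toReal_pow, ENNReal.toReal_pow, toReal_enorm, toReal_enorm] at h
  exact lt_of_pow_lt_pow_left₀ 2 (norm_nonneg _) h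

end BergmanPolydisc

/-! ### The theorem for invariant subspaces of the Bergman space -/

theorem theorem3p1 {n : ℕ} (S : Submodule ℂ (BergmanSpace n))
    (hclosed : IsClosed (S : Set (BergmanSpace n)))
    (hinv : ∀ i : Fin n, ∀ f ∈ S, coordMul i f ∈ S)
    (hdc : haveI : CompleteSpace S := hclosed.completeSpace_coe
      IsDoublyCommuting (restrictedCoordMul S hinv))
    {k : ℕ} (hk : 0 < k) (α : Fin k → Fin n) (hα : Function.Injective α) :
    IsWanderingSubspace (fun j => restrictedCoordMul S hinv (α j))
      (defectSpace (fun j => restrictedCoordMul S hinv (α j))) := by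
  have : CompleteSpace S := hclosed.completeSpace_coe
  obtain ⟨hcomm, hstar⟩ := hdc
  -- The hypothesis covers i < j only, while `α` may list indices in any order; taking adjoints
  -- gives the case i > j.
  have hstar' : ∀ i j, i ≠ j → restrictedCoordMul S hinv i ∘L (restrictedCoordMul S hinv j).adjoint
      = (restrictedCoordMul S hinv j).adjoint ∘L restrictedCoordMul S hinv i := by
    intro i j hij
    rcases lt_or_gt_of_ne hij with h | h
    · exact hstar i j h
    · have := congrArg ContinuousLinearMap.adjoint (hstar j i h)
      rw [ContinuousLinearMap.adjoint_comp, ContinuousLinearMap.adjoint_comp,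
        ContinuousLinearMap.adjoint_adjoint] at this
      exact this
  refine isWanderingSubspace_defectSpace _ (fun j x y => ?_) (fun j x hx => ?_)
    (fun i j => hcomm _ _) (fun i j hij => hstar' _ _ (hα.ne hij))
  -- The norm of S is that of L², so the inequality on the Bergman space applies to vectors of S
  -- unchanged.
  · exact norm_coordMulLp_add_sq_le (α j) (f := (show bergman n from x.1).1)
      (g := (show bergman n from y.1).1) (show bergman n from x.1).2 (show bergman n from y.1).2
  · refine norm_coordMulLp_lt (α j) (f := (show bergman n from x.1).1) fun h => hx ?_
    exact Subtype.ext (Subtype.ext h)
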